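/- For real numbers $x,l\ge 1$ put $$f(x,l)=x\left(\frac{\Gamma(xl^7+1)}{\Gamma(x+1)}\right)^3 ,$$ where $\Gamma$ is the Euler gamma function. For a finite graph $G$, let $\mathcal I(G)$ be the family of its independent vertex sets, and let $\chi_f(G)$, the fractional chromatic number of $G$, be the minimum of $\sum_{I\in\mathcal I(G)}y_I$ over all families $(y_I)_{I\in\mathcal I(G)}$ of non-negative reals such that $\sum_{I\in\mathcal I(G),\,v\in I}y_I\ge 1$ for every vertex $v$. Let $G$ be a finite graph with vertex set $V$, let $w:V\to[0,\infty)$ be a weight function, write $w(A)=\sum_{v\in A}w(v)$ for $A\subseteq V$, and assume $w(V)\neq 0$. Let $<$ be a linear order on $V$ such that $u<v$ implies $w(u)\ge w(v)$. For $v\in V$ let $N^L(v)=\{u\in V: uv\in E(G),\ u<v\}$, and let $\chi_f(N^L(v))$ be the fractional chromatic number of the subgraph of $G$ induced by $N^L(v)$. Let $x\ge 59$ and $l\ge 1$ be real numbers. Suppose that $w(I)\le w(V)/f(x,l)$ for every $I\in\mathcal I(G)$, and that $\chi_f(N^L(v))\le l$ for every $v\in V$. Then $G$ contains a triangle-free spanning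 subgraph $H$ such that $w(I)\le w(V)/x$ for every $I\in\mathcal I(H)$. In particular, $\chi_f(H)\ge x$. -/

import Mathlib

open scoped Classical in
/-- The family of all independent sets of a finite graph. -/
noncomputable def indepSets {V : Type*} [Fintype V] (G : SimpleGraph V) : Finset (Finset V) :=
  Finset.univ.filter fun I => G.IsIndepSet (I : Set V)

open scoped Classical in
/-- A fractional colouring: non-negative weights on the independent sets such that, for every
vertex, the independent sets containing it have total weight at least `1`. -/
def IsFractionalColoring {V : Type*} [Fintype V] (G : SimpleGraph V) (y : Finset V → ℝ) : Prop :=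
  (∀ I ∈ indepSets G, 0 ≤ y I) ∧ ∀ v : V, 1 ≤ ∑ I ∈ (indepSets G).filter (fun I => v ∈ I), y I

/-- The fractional chromatic number of a finite graph: the smallest total weight of a fractional
colouring. The set is non-empty and bounded below by `0`, and (by compactness) it has a least
element, so the infimum is the minimum. -/
noncomputable def fractionalChromaticNumber {V : Type*} [Fintype V] (G : SimpleGraph V) : ℝ :=
  sInf {c : ℝ | ∃ y : Finset V → ℝ, IsFractionalColoring G y ∧ c = ∑ I ∈ indepSets G, y I}

/-- The left neighbourhood of `v`: the neighbours of `v` that appear before `v` in the linear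
order of the vertices. -/
def leftNeighborSet {V : Type*} [LinearOrder V] (G : SimpleGraph V) (v : V) : Set V :=
  {u | G.Adj u v ∧ u < v}

noncomputable instance instFintypeLeftNeighborSet {V : Type*} [Fintype V] [LinearOrder V]
    (G : SimpleGraph V) (v : V) : Fintype (leftNeighborSet G v) :=
  Fintype.ofFinite _

/-- The function `f(x, l) = x (Γ(x l ^ 7 + 1) / Γ(x + 1)) ^ 3`. -/
noncomputable def gammaBound (x l : ℝ) : ℝ :=
  x * (Real.Gamma (x * l ^ 7 + 1) / Real.Gamma (x + 1)) ^ 3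

/-! Induct on `t = x * l ^ 7`. If `l < 2`, left neighbourhoods are independent and `G` is already
triangle-free. Otherwise choose `x'` slightly above `x` and `l'` slightly below `l` with `x' * l' ^
7 = t - 2`. Call a set a piece if its left neighbourhoods are `l'`-colourable and its share of the
weight exceeds `1 / (t * (t - 1)) ^ 3`. The Gamma factors in `f` make the induction hypothesis apply
to pieces. Take a largest set `U` that carries a good subgraph for `x'`; its complement contains no
piece. If the complement is light, the slack between `x` and `x'` pays for it.

If it is heavy, build a subgraph on it at random (`exists_triangleFree_of_no_piece`): each vertex
picks an independent set from a fractional colouring of its left neighbourhood and keeps only its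
left edges into that set. No triangle survives. In a heavy set `S`, the vertices whose pick is not
likely to meet their left neighbours in `S` induce `l'`-colourable left neighbourhoods, by
conditioning; as there is no piece, they are light. Summation by parts turns this weighted statement
into a count on some initial segment, and a union bound over dense sets shows that some choice puts
an edge into every heavy set. -/

/-! ### Summation by parts and the union bound -/

open Finset in
/-- Summation by parts: if all initial sums of `g` are non-positive, so is its sum against a
non-negative antitone weight. -/
theorem sum_mul_nonpos_of_prefix_sums_nonpos {V : Type*} [LinearOrder V] (g : V → ℝ)
    (R : Finset V) : ∀ w : V → ℝ, (∀ v ∈ R, 0 ≤ w v) →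
    (∀ u ∈ R, ∀ v ∈ R, u < v → w v ≤ w u) →
    (∀ v ∈ R, ∑ u ∈ R with u ≤ v, g u ≤ 0) → ∑ v ∈ R, w v * g v ≤ 0 := by
  induction R using Finset.induction_on_max with
  | empty => simp
  | insert m R hm ih =>
    intro w hw hanti hpre
    have hmR : m ∉ R := fun h => lt_irrefl _ (hm m h)
    -- Split `w` as `(w - w m) + w m`: the first part is still non-negative and antitone on `R`, the
    -- second multiplies a full initial sum.
    have h1 : ∑ v ∈ R, (w v - w m) * g v ≤ 0 := by
      apply ih
      · intro v hv
        have := hanti v (mem_insert_of_mem hv) m (mem_insert_self _ _) (hm v hv)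
        linarith
      · intro u hu v hv huv
        have := hanti u (mem_insert_of_mem hu) v (mem_insert_of_mem hv) huv
        linarith
      · intro v hv
        have := hpre v (mem_insert_of_mem hv)
        rwa [filter_insert, if_neg (not_le.mpr (hm v hv))] at this
    have h2 : w m * ∑ v ∈ insert m R, g v ≤ 0 := by
      apply mul_nonpos_of_nonneg_of_nonpos (hw m (mem_insert_self _ _))
      have := hpre m (mem_insert_self _ _)
      rwa [filter_true_of_mem] at this
      intro u hu
      rcases mem_insert.mp hu with rfl | h
      · exact le_rfl
      · exact (hm u h).le
    rw [sum_insert hmR] at h2 ⊢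
    simp only [sub_mul, sum_sub_distrib, ← mul_sum] at h1
    linarith

open Finset in
/-- The first moment method for independent choices. -/
theorem exists_choice_of_sum_pow_lt_one {V α τ : Type*} [Fintype V] [DecidableEq V] [Fintype α]
    (y : V → α → ℝ) (hy : ∀ v a, 0 ≤ y v a) (hy1 : ∀ v, ∑ a, y v a = 1)
    (F : Finset τ) (D : τ → Finset V) (hit : V → τ → α → Prop)
    [∀ v T, DecidablePred (hit v T)] (q : ℝ)
    (hq : ∀ T ∈ F, ∀ v ∈ D T, ∑ a with ¬ hit v T a, y v a ≤ q)
    (hsum : ∑ T ∈ F, q ^ #(D T) < 1) :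
    ∃ c : V → α, (∀ v, y v (c v) ≠ 0) ∧ ∀ T ∈ F, ∃ v ∈ D T, hit v T (c v) := by
  by_contra hcon
  push Not at hcon
  -- The left side is the probability that no vertex of `D T` hits `T`; independence turns it into a
  -- product.
  have key : ∀ T ∈ F,
      ∑ c : V → α, ∏ v, (if v ∈ D T ∧ hit v T (c v) then 0 else y v (c v)) ≤ q ^ #(D T) := by
    intro T hT
    rw [← Fintype.prod_sum (fun v a => if v ∈ D T ∧ hit v T a then 0 else y v a)]
    rw [← prod_const, ← prod_subset (subset_univ (D T))]
    · apply prod_le_prod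
      · intro v _
        exact sum_nonneg fun a _ => by split_ifs <;> simp [hy]
      · intro v hv
        refine le_trans (le_of_eq ?_) (hq T hT v hv)
        rw [sum_filter]
        refine sum_congr rfl fun a _ => ?_
        by_cases h : hit v T a <;> simp [h, hv]
    · intro v _ hv
      simp [hv, hy1]
  have h1 : ∑ c : V → α, ∏ v, y v (c v) = 1 := by
    rw [← Fintype.prod_sum]
    simp [hy1]
  have h2 : ∑ c : V → α, ∏ v, y v (c v) ≤
      ∑ c : V → α, ∑ T ∈ F, ∏ v, (if v ∈ D T ∧ hit v T (c v) then 0 else y v (c v)) := by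
    refine sum_le_sum fun c _ => ?_
    have hnn : ∀ T ∈ F, 0 ≤ ∏ v, (if v ∈ D T ∧ hit v T (c v) then 0 else y v (c v)) :=
      fun T _ => prod_nonneg fun v _ => by split_ifs <;> simp [hy]
    by_cases hc : ∀ v, y v (c v) ≠ 0
    · obtain ⟨T, hT, h⟩ := hcon c hc
      refine le_trans (le_of_eq ?_) (single_le_sum hnn hT)
      refine prod_congr rfl fun v _ => ?_
      rw [if_neg]
      exact fun hv => h v hv.1 hv.2
    · push Not at hc
      obtain ⟨v, hv⟩ := hc
      rw [prod_eq_zero (mem_univ v) hv]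
      exact sum_nonneg hnn
  rw [sum_comm, h1] at h2
  linarith [sum_le_sum key]

open Finset in
/-- A geometric bound for the sets that are dense in an initial segment of `R`. -/
theorem sum_pow_card_dense_lt_one {V : Type*} [LinearOrder V] (R : Finset V)
    (F : Finset (Finset V)) (κ r : ℝ) (hκ : 0 ≤ κ) (hr : 0 ≤ r)
    (hκr : κ * Real.exp 1 * r ≤ 1 / 3)
    (hF : ∀ T ∈ F, T.Nonempty ∧ T ⊆ R ∧ ∀ u ∈ T, (#{a ∈ R | a ≤ u} : ℝ) ≤ κ * #T) :
    ∑ T ∈ F, r ^ #T < 1 := by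
  classical
  -- `P m` is an initial segment of `R` with at most `κ * m` elements, and it contains every
  -- `m`-element member of `F`.
  let P : ℕ → Finset V := fun m => {u ∈ R | (#{a ∈ R | a ≤ u} : ℝ) ≤ κ * m}
  have hP : ∀ m, (#(P m) : ℝ) ≤ κ * m := by
    intro m
    rcases (P m).eq_empty_or_nonempty with h | h
    · rw [h]; simp; positivity
    · have hmax := (P m).max'_mem h
      have hmax2 := (mem_filter.mp hmax).2
      refine le_trans ?_ hmax2
      exact_mod_cast card_le_card fun u hu =>
        mem_filter.mpr ⟨(mem_filter.mp hu).1, le_max' _ _ hu⟩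
  have hm : ∀ m, ∑ T ∈ powersetCard m (P m), r ^ #T ≤ (1 / 3 : ℝ) ^ m := by
    intro m
    have h1 : ∑ T ∈ powersetCard m (P m), r ^ #T = ((#(P m)).choose m : ℝ) * r ^ m := by
      rw [sum_congr rfl (g := fun _ => r ^ m)
        (fun T hT => by rw [(mem_powersetCard.mp hT).2])]
      simp
    have h2 : ((#(P m)).choose m : ℝ) ≤ (κ * Real.exp 1) ^ m := by
      calc ((#(P m)).choose m : ℝ) ≤ (#(P m) : ℝ) ^ m / (m.factorial : ℝ) :=
            Nat.choose_le_pow_div _ _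
        _ ≤ (κ * m) ^ m / (m.factorial : ℝ) := by gcongr; exact hP m
        _ = κ ^ m * ((m : ℝ) ^ m / (m.factorial : ℝ)) := by rw [mul_pow]; ring
        _ ≤ κ ^ m * Real.exp m := by
            gcongr
            exact Real.pow_div_factorial_le_exp _ (Nat.cast_nonneg m) m
        _ = (κ * Real.exp 1) ^ m := by rw [mul_pow, ← Real.exp_nat_mul]; simp
    rw [h1]
    calc _ ≤ (κ * Real.exp 1) ^ m * r ^ m := by gcongr
      _ = (κ * Real.exp 1 * r) ^ m := by rw [mul_pow _ r]
      _ ≤ _ := by gcongr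
  have hsub : F ⊆ (Ico 1 (#R + 1)).biUnion fun m => powersetCard m (P m) := by
    intro T hT
    obtain ⟨h1, h2, h3⟩ := hF T hT
    rw [mem_biUnion]
    refine ⟨#T, ?_, mem_powersetCard.mpr ⟨fun u hu => mem_filter.mpr ⟨h2 hu, h3 u hu⟩, rfl⟩⟩
    have := card_le_card h2
    have := h1.card_pos
    rw [mem_Ico]; omega
  calc ∑ T ∈ F, r ^ #T
      ≤ ∑ T ∈ (Ico 1 (#R + 1)).biUnion fun m => powersetCard m (P m), r ^ #T :=
        sum_le_sum_of_subset_of_nonneg hsub fun _ _ _ => by positivity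
    _ = ∑ m ∈ Ico 1 (#R + 1), ∑ T ∈ powersetCard m (P m), r ^ #T := by
        refine sum_biUnion fun i _ j _ hij => disjoint_left.mpr fun T hT hT' => hij ?_
        rw [← (mem_powersetCard.mp hT).2, (mem_powersetCard.mp hT').2]
    _ ≤ ∑ m ∈ Ico 1 (#R + 1), (1 / 3 : ℝ) ^ m := sum_le_sum fun m _ => hm m
    _ < 1 := by
        have : ∀ n : ℕ, ∑ m ∈ Ico 1 (n + 1), (1 / 3 : ℝ) ^ m = (1 - (1 / 3 : ℝ) ^ n) / 2 := by
          intro n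
          induction n with
          | zero => simp
          | succ n ih => rw [sum_Ico_succ_top (by omega), ih]; ring
        rw [this]
        have : (0 : ℝ) < (1 / 3 : ℝ) ^ #R := by positivity
        linarith


/-! ### Fractional colourings as probability distributions -/

/-- A probability distribution on the independent sets of `G` such that every vertex of `A` is
covered with probability at least `1 / l`. -/
def FracColorableOn {V : Type*} [Fintype V] [DecidableEq V] (G : SimpleGraph V) (A : Finset V)
    (l : ℝ) : Prop :=
  ∃ y : Finset V → ℝ, (∀ I, 0 ≤ y I) ∧ (∀ I, y I ≠ 0 → G.IsIndepSet (I : Set V)) ∧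
    ∑ I, y I = 1 ∧ ∀ u ∈ A, 1 ≤ l * ∑ I with u ∈ I, y I

open scoped Classical in
/-- The left neighbours of `v` that lie in `S`. -/
noncomputable def leftNeighborsIn {V : Type*} [LinearOrder V] (G : SimpleGraph V) (S : Finset V)
    (v : V) : Finset V :=
  S.filter fun u => G.Adj u v ∧ u < v

theorem mem_leftNeighborsIn {V : Type*} [LinearOrder V] {G : SimpleGraph V} {S : Finset V}
    {u v : V} : u ∈ leftNeighborsIn G S v ↔ u ∈ S ∧ G.Adj u v ∧ u < v := by
  simp [leftNeighborsIn]

theorem leftNeighborsIn_mono {V : Type*} [LinearOrder V] (G : SimpleGraph V) {S T : Finset V}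
    (h : S ⊆ T) (v : V) : leftNeighborsIn G S v ⊆ leftNeighborsIn G T v :=
  fun _ hu => mem_leftNeighborsIn.mpr
    ⟨h (mem_leftNeighborsIn.mp hu).1, (mem_leftNeighborsIn.mp hu).2⟩

namespace FracColorableOn

variable {V : Type*} [Fintype V] [DecidableEq V] {G : SimpleGraph V} {A B : Finset V} {l l' : ℝ}

theorem mono (h : FracColorableOn G B l) (hAB : A ⊆ B) : FracColorableOn G A l := by
  obtain ⟨y, h0, h1, h2, h3⟩ := h
  exact ⟨y, h0, h1, h2, fun u hu => h3 u (hAB hu)⟩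

theorem empty (G : SimpleGraph V) (l : ℝ) : FracColorableOn G ∅ l := by
  refine ⟨Pi.single ∅ 1, fun I => ?_, fun I hI => ?_, by simp, by simp⟩
  · by_cases h : I = ∅
    · subst h; simp
    · simp [h]
  · have : I = ∅ := by by_contra h; simp [h] at hI
    subst this; simp

/-- Conditioning the distribution on the event that the independent set meets `A`. -/
theorem of_sum_meeting_le {y : Finset V → ℝ} (h0 : ∀ I, 0 ≤ y I)
    (h1 : ∀ I, y I ≠ 0 → G.IsIndepSet (I : Set V)) (hl : 0 < l)
    (h3 : ∀ u ∈ A, 1 ≤ l * ∑ I with u ∈ I, y I)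
    (hp : ∑ I with ¬ Disjoint I A, y I ≤ l' / l) : FracColorableOn G A l' := by
  classical
  set p := ∑ I with ¬ Disjoint I A, y I with hpdef
  have hsub : ∀ u ∈ A, ∑ I with u ∈ I, y I ≤ p := fun u hu =>
    Finset.sum_le_sum_of_subset_of_nonneg
      (fun I hI => by
        simp only [Finset.mem_filter, Finset.mem_univ, true_and] at hI ⊢
        exact Finset.not_disjoint_iff.mpr ⟨u, hI, hu⟩) fun _ _ _ => h0 _
  have hp0 : 0 ≤ p := Finset.sum_nonneg fun _ _ => h0 _
  rcases hp0.eq_or_lt with hpz | hpos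
  · have : A = ∅ := by
      rw [Finset.eq_empty_iff_forall_notMem]
      intro u hu
      have := h3 u hu
      have := mul_le_mul_of_nonneg_left (hsub u hu) hl.le
      rw [← hpz] at this
      linarith
    subst this
    exact empty G l'
  · refine ⟨fun I => if ¬ Disjoint I A then y I / p else 0, fun I => ?_, fun I hI => ?_, ?_, ?_⟩
    · have := h0 I
      dsimp only
      split_ifs <;> positivity
    · refine h1 I fun h => hI ?_
      simp [h]
    · rw [← Finset.sum_filter, ← Finset.sum_div, ← hpdef, div_self hpos.ne']
    · intro u hu
      have h4 : ∑ I with u ∈ I, (if ¬ Disjoint I A then y I / p else 0) =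
          (∑ I with u ∈ I, y I) / p := by
        rw [Finset.sum_div]
        refine Finset.sum_congr rfl fun I hI => ?_
        rw [if_pos (Finset.not_disjoint_iff.mpr ⟨u, (Finset.mem_filter.mp hI).2, hu⟩)]
      rw [h4, ← mul_div_assoc, le_div_iff₀ hpos, one_mul]
      have hlp : p * l ≤ l' := (le_div_iff₀ hl).mp hp
      have h5 : 0 ≤ ∑ I with u ∈ I, y I := Finset.sum_nonneg fun _ _ => h0 _
      have h6 := mul_le_mul_of_nonneg_left (h3 u hu) hpos.le
      have h7 := mul_le_mul_of_nonneg_right hlp h5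
      linarith

/-- A set with fractional chromatic number less than `2` is independent. -/
theorem isIndepSet (h : FracColorableOn G A l) (hl : 0 < l) (hl2 : l < 2) :
    G.IsIndepSet (A : Set V) := by
  obtain ⟨y, h0, h1, h2, h3⟩ := h
  intro u hu v hv huv hadj
  have hu' := h3 u hu
  have hv' := h3 v hv
  -- No independent set contains both ends of an edge, yet each end has probability at least `1 / l
  -- > 1 / 2`.
  have hle : ∑ I with u ∈ I, y I + ∑ I with v ∈ I, y I ≤ 1 := by
    rw [← h2, Finset.sum_filter, Finset.sum_filter, ← Finset.sum_add_distrib]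
    refine Finset.sum_le_sum fun I _ => ?_
    by_cases hz : y I = 0
    · simp [hz]
    · by_cases hui : u ∈ I <;> by_cases hvi : v ∈ I <;> simp [hui, hvi, h0]
      exact (h1 I hz hui hvi huv hadj).elim
  nlinarith

end FracColorableOn

/-! ### The random triangle-free subgraph -/

/-- A triangle-free subgraph of `G` with all edges inside `S` whose independent subsets of `S` have
weight at most `1 / x` of the weight of `S`. -/
def HasSparseTriangleFree {V : Type*} (G : SimpleGraph V) (w : V → ℝ) (S : Finset V)
    (x : ℝ) : Prop :=
  ∃ H : SimpleGraph V, H ≤ G ∧ (∀ a b, H.Adj a b → a ∈ S ∧ b ∈ S) ∧ H.CliqueFree 3 ∧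
    ∀ I ⊆ S, H.IsIndepSet (I : Set V) → ∑ v ∈ I, w v ≤ (∑ v ∈ S, w v) / x

theorem cliqueFree_three_of_left {V : Type*} [LinearOrder V] {H : SimpleGraph V}
    (h : ∀ u v z, u < v → v < z → H.Adj u z → H.Adj v z → ¬ H.Adj u v) : H.CliqueFree 3 := by
  intro s hs
  rw [SimpleGraph.is3Clique_iff] at hs
  obtain ⟨a, b, c, hab, hac, hbc, -⟩ := hs
  have hba := hab.symm
  have hca := hac.symm
  have hcb := hbc.symm
  rcases lt_or_gt_of_ne hab.ne with h1 | h1 <;> rcases lt_or_gt_of_ne hac.ne with h2 | h2 <;>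
    rcases lt_or_gt_of_ne hbc.ne with h3 | h3
  · exact h a b c h1 h3 hac hbc hab
  · exact h a c b h2 h3 hab hcb hac
  · exact (lt_asymm (h1.trans h3) h2).elim
  · exact h c a b h2 h1 hcb hab hca
  · exact h b a c h1 h2 hbc hac hba
  · exact (lt_asymm (h1.trans h2) h3).elim
  · exact h b c a h3 h2 hba hca hbc
  · exact h c b a h3 h1 hca hba hcb

open Finset in
open scoped Classical in
/-- The random choice of independent left neighbourhoods. -/
theorem exists_triangleFree_of_no_piece {V : Type*} [Fintype V] [LinearOrder V]
    (G : SimpleGraph V) (w : V → ℝ) (hw : ∀ v, 0 ≤ w v)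
    (horder : ∀ u v : V, u < v → w v ≤ w u) (R : Finset V) (x t l l' θ : ℝ)
    (hx : 0 < x) (ht : 3 ≤ t) (hl : 0 < l) (hratio : 1 - l' / l ≤ 3 / t)
    (hxt : 2 * x * Real.exp 1 * (6 / t) ≤ 1 / 3)
    (hcol : ∀ v ∈ R, FracColorableOn G (leftNeighborsIn G R v) l)
    (hθ : ∀ A ⊆ R, (∀ v ∈ A, FracColorableOn G (leftNeighborsIn G A v) l') → ∑ v ∈ A, w v ≤ θ)
    (hθW : (t + 2) * θ ≤ (∑ v ∈ R, w v) / (2 * x)) :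
    HasSparseTriangleFree G w R x := by
  -- The product space runs over all of `V`, so vertices outside `R` get a dummy distribution.
  have hcol' : ∀ v, ∃ y : Finset V → ℝ, (∀ I, 0 ≤ y I) ∧
      (∀ I, y I ≠ 0 → G.IsIndepSet (I : Set V)) ∧ ∑ I, y I = 1 ∧
      (v ∈ R → ∀ u ∈ leftNeighborsIn G R v, 1 ≤ l * ∑ I with u ∈ I, y I) := by
    intro v
    by_cases hv : v ∈ R
    · obtain ⟨y, a, b, c, d⟩ := hcol v hv
      exact ⟨y, a, b, c, fun _ => d⟩
    · obtain ⟨y, a, b, c, -⟩ := FracColorableOn.empty G l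
      exact ⟨y, a, b, c, fun h => (hv h).elim⟩
  choose y hy0 hyI hy1 hyl using hcol'
  let hit : V → Finset V → Finset V → Prop := fun v T I =>
    ¬ Disjoint I (leftNeighborsIn G T v)
  -- `D T` holds the vertices likely to send an edge into `T`; `F` collects the dense sets in which
  -- almost all vertices are of this kind.
  let D : Finset V → Finset V := fun T => {v ∈ T | l' / l < ∑ I with hit v T I, y v I}
  let F : Finset (Finset V) := {T | T.Nonempty ∧ T ⊆ R ∧
    (∀ u ∈ T, (#{a ∈ R | a ≤ u} : ℝ) ≤ 2 * x * #T) ∧ t * #(T \ D T) ≤ #(D T)}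
  have hq : ∀ T ∈ F, ∀ v ∈ D T, ∑ I with ¬ hit v T I, y v I ≤ 3 / t := by
    intro T _ v hv
    have h1 := (mem_filter.mp hv).2
    have h2 := sum_filter_add_sum_filter_not univ (hit v T) (y v)
    rw [hy1] at h2
    linarith
  have hpow : ∀ T ∈ F, (3 / t) ^ #(D T) ≤ (6 / t) ^ #T := by
    intro T hT
    have h1 := (mem_filter.mp hT).2.2.2.2
    have hcard : #T = #(D T) + #(T \ D T) := by
      have := card_sdiff_add_card_eq_card (show D T ⊆ T from filter_subset _ _)
      omega
    set d := #(D T)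
    set b := #(T \ D T)
    -- The `b` exceptional vertices cost little: `t / 6 ≤ 2 ^ ⌊t⌋₊` and `⌊t⌋₊ * b ≤ d`, so doubling
    -- the base `3 / t` covers them.
    have h2 : (t / 6) ^ b ≤ 2 ^ d := by
      have h3 : ⌊t⌋₊ * b ≤ d := by
        have : (⌊t⌋₊ : ℝ) * b ≤ d :=
          le_trans (by gcongr; exact Nat.floor_le (by linarith)) h1
        exact_mod_cast this
      calc (t / 6) ^ b ≤ ((2 : ℝ) ^ ⌊t⌋₊) ^ b := by
            gcongr
            have h4 : t < ⌊t⌋₊ + 1 := Nat.lt_floor_add_one t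
            have h5 : ((⌊t⌋₊ + 1 : ℕ) : ℝ) ≤ ((2 ^ ⌊t⌋₊ : ℕ) : ℝ) := by
              exact_mod_cast Nat.succ_le_of_lt Nat.lt_two_pow_self
            push_cast at h5
            linarith
        _ = 2 ^ (⌊t⌋₊ * b) := by rw [pow_mul]
        _ ≤ 2 ^ d := pow_le_pow_right₀ (by norm_num) h3
    have ht0 : 0 < t := by linarith
    calc (3 / t) ^ d = (3 / t) ^ d * ((t / 6) ^ b * (6 / t) ^ b) := by
          rw [← mul_pow]
          have : t / 6 * (6 / t) = 1 := by field_simp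
          rw [this, one_pow, mul_one]
      _ ≤ (3 / t) ^ d * (2 ^ d * (6 / t) ^ b) := by gcongr
      _ = (6 / t) ^ #T := by
          rw [hcard, pow_add, ← mul_assoc, ← mul_pow]
          congr 2
          ring
  have hsum : ∑ T ∈ F, (3 / t) ^ #(D T) < 1 := by
    refine lt_of_le_of_lt (sum_le_sum hpow) ?_
    refine sum_pow_card_dense_lt_one R F (2 * x) (6 / t) (by positivity) (by positivity) hxt ?_
    intro T hT
    obtain ⟨-, a, b, c, -⟩ := mem_filter.mp hT
    exact ⟨a, b, c⟩
  obtain ⟨c, hc0, hcF⟩ := exists_choice_of_sum_pow_lt_one y hy0 hy1 F D hit (3 / t) hq hsum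
  let H : SimpleGraph V := SimpleGraph.fromRel fun a b =>
    b ∈ R ∧ a ∈ leftNeighborsIn G R b ∧ a ∈ c b
  have hH : ∀ a b, a < b → (H.Adj a b ↔ b ∈ R ∧ a ∈ leftNeighborsIn G R b ∧ a ∈ c b) := by
    intro a b hab
    simp only [H, SimpleGraph.fromRel_adj]
    refine ⟨?_, fun h => ⟨hab.ne, Or.inl h⟩⟩
    rintro ⟨-, h | h⟩
    · exact h
    · exact (lt_asymm hab (mem_leftNeighborsIn.mp h.2.1).2.2).elim
  have hHG : H ≤ G := by
    intro a b h
    obtain ⟨-, h | h⟩ := (SimpleGraph.fromRel_adj _ _ _).mp h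
    · exact (mem_leftNeighborsIn.mp h.2.1).2.1
    · exact (mem_leftNeighborsIn.mp h.2.1).2.1.symm
  refine ⟨H, hHG, ?_, ?_, ?_⟩
  · intro a b h
    obtain ⟨-, h | h⟩ := (SimpleGraph.fromRel_adj _ _ _).mp h
    · exact ⟨(mem_leftNeighborsIn.mp h.2.1).1, h.1⟩
    · exact ⟨h.1, (mem_leftNeighborsIn.mp h.2.1).1⟩
  · refine cliqueFree_three_of_left fun u v z huv hvz huz hvz' huv' => ?_
    have h1 := ((hH u z (huv.trans hvz)).mp huz).2.2
    have h2 := ((hH v z hvz).mp hvz').2.2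
    exact hyI z (c z) (hc0 z) h1 h2 huv.ne (hHG huv')
  · intro S hSR hS
    by_contra! hcon
    set W := ∑ v ∈ R, w v with hWdef
    have hDS : D S ⊆ S := filter_subset _ _
    have hBθ : ∑ v ∈ S \ D S, w v ≤ θ := by
      refine hθ _ (sdiff_subset.trans hSR) fun v hv => ?_
      rw [mem_sdiff] at hv
      have hvR := hSR hv.1
      refine FracColorableOn.mono (B := leftNeighborsIn G S v) ?_
        (leftNeighborsIn_mono G sdiff_subset v)
      refine FracColorableOn.of_sum_meeting_le (hy0 v) (hyI v) hl
        (fun u hu => hyl v hvR u (leftNeighborsIn_mono G hSR v hu)) ?_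
      have : ¬ (l' / l < ∑ I with hit v S I, y v I) := fun h =>
        hv.2 (mem_filter.mpr ⟨hv.1, h⟩)
      exact not_lt.mp this
    -- A positive initial sum of `g` gives both properties that define `F`: density and few
    -- exceptional vertices.
    let g : V → ℝ := fun v => (if v ∈ D S then 1 else 0) - t * (if v ∈ S \ D S then 1 else 0)
      - 1 / (2 * x)
    have hgsum : 0 < ∑ v ∈ R, w v * g v := by
      have e1 : ∑ v ∈ R, w v * (if v ∈ D S then (1 : ℝ) else 0) = ∑ v ∈ D S, w v := by
        simp only [mul_ite, mul_one, mul_zero]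
        rw [sum_ite_mem, inter_eq_right.mpr (hDS.trans hSR)]
      have e2 : ∑ v ∈ R, w v * (if v ∈ S \ D S then (1 : ℝ) else 0) = ∑ v ∈ S \ D S, w v := by
        simp only [mul_ite, mul_one, mul_zero]
        rw [sum_ite_mem, inter_eq_right.mpr (sdiff_subset.trans hSR)]
      have e3 : ∑ v ∈ R, w v * g v =
          ∑ v ∈ D S, w v - t * ∑ v ∈ S \ D S, w v - W / (2 * x) := by
        rw [← e1, ← e2, hWdef, mul_sum, sum_div, ← sum_sub_distrib, ← sum_sub_distrib]
        refine sum_congr rfl fun v _ => ?_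
        simp only [g]; ring
      have e4 := sum_sdiff (f := w) hDS
      have e5 : W / x = W / (2 * x) + W / (2 * x) := by field_simp; ring
      have e6 : (t + 1) * ∑ v ∈ S \ D S, w v ≤ (t + 1) * θ := by gcongr
      have e7 : 0 ≤ θ := le_trans (sum_nonneg fun v _ => hw v) hBθ
      rw [e3]
      linarith
    obtain ⟨m, hmR, hm⟩ : ∃ m ∈ R, 0 < ∑ u ∈ R with u ≤ m, g u := by
      by_contra! h
      exact absurd (sum_mul_nonpos_of_prefix_sums_nonpos g R w (fun v _ => hw v)
        (fun u _ v _ => horder u v) h) (not_le.mpr hgsum)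
    let T : Finset V := {u ∈ S | u ≤ m}
    have hTS : T ⊆ S := filter_subset _ _
    -- Truncating to an initial segment keeps left neighbourhoods, so `D T` is the part of `D S` in
    -- `T`.
    have hleft : ∀ u ∈ T, leftNeighborsIn G T u = leftNeighborsIn G S u := by
      intro u hu
      ext a
      have hum := (mem_filter.mp hu).2
      simp only [mem_leftNeighborsIn, T, mem_filter]
      constructor
      · rintro ⟨h1, h2⟩; exact ⟨h1.1, h2⟩
      · rintro ⟨h1, h2⟩; exact ⟨⟨h1, h2.2.le.trans hum⟩, h2⟩
    have hDT : ∀ u ∈ T, (u ∈ D T ↔ u ∈ D S) := by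
      intro u hu
      simp only [D, hit, mem_filter, hu, hTS hu, true_and, hleft u hu]
    have hcount : (#{a ∈ R | a ≤ m} : ℝ) / (2 * x) + t * #(T \ D T) < #(D T) := by
      have f1 : ∑ u ∈ R with u ≤ m, (if u ∈ D S then (1 : ℝ) else 0) = #(D T) := by
        rw [sum_boole]
        congr 2
        ext u
        simp only [mem_filter]
        constructor
        · rintro ⟨⟨_, h1⟩, h2⟩
          exact (hDT u (mem_filter.mpr ⟨hDS h2, h1⟩)).mpr h2
        · intro h
          have hT := (mem_filter.mp h).1
          exact ⟨⟨hSR (hTS hT), (mem_filter.mp hT).2⟩, (hDT u hT).mp h⟩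
      have f2 : ∑ u ∈ R with u ≤ m, (if u ∈ S \ D S then (1 : ℝ) else 0) = #(T \ D T) := by
        rw [sum_boole]
        congr 2
        ext u
        simp only [mem_filter, mem_sdiff]
        constructor
        · rintro ⟨⟨_, h1⟩, h2, h3⟩
          have hT : u ∈ T := mem_filter.mpr ⟨h2, h1⟩
          exact ⟨hT, fun h => h3 ((hDT u hT).mp h)⟩
        · rintro ⟨hT, h⟩
          exact ⟨⟨hSR (hTS hT), (mem_filter.mp hT).2⟩, hTS hT, fun h' => h ((hDT u hT).mpr h')⟩
      simp only [g, sum_sub_distrib, ← mul_sum, f1, f2, sum_const, nsmul_eq_mul] at hm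
      have : (#{a ∈ R | a ≤ m} : ℝ) * (1 / (2 * x)) = (#{a ∈ R | a ≤ m} : ℝ) / (2 * x) := by ring
      linarith
    have hDTle : (#(D T) : ℝ) ≤ #T := by
      exact_mod_cast card_le_card (filter_subset _ _ : D T ⊆ T)
    have hn1 : 0 ≤ t * (#(T \ D T) : ℝ) := by positivity
    have hn2 : 0 ≤ (#{a ∈ R | a ≤ m} : ℝ) / (2 * x) := by positivity
    have hTF : T ∈ F := by
      refine mem_filter.mpr ⟨mem_univ _, ?_, hTS.trans hSR, fun u hu => ?_, by linarith⟩
      · rw [← card_pos]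
        have : (0 : ℝ) < #T := by linarith
        exact_mod_cast this
      · have hum := (mem_filter.mp hu).2
        have h1 : (#{a ∈ R | a ≤ u} : ℝ) ≤ #{a ∈ R | a ≤ m} := by
          exact_mod_cast card_le_card fun a ha =>
            mem_filter.mpr ⟨(mem_filter.mp ha).1, le_trans (mem_filter.mp ha).2 hum⟩
        have h2 : (#{a ∈ R | a ≤ m} : ℝ) / (2 * x) ≤ #T := by linarith
        rw [div_le_iff₀ (by positivity)] at h2
        linarith
    obtain ⟨v, hvD, hv⟩ := hcF T hTF
    have hvT : v ∈ T := (mem_filter.mp hvD).1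
    obtain ⟨a, hac, haN⟩ := not_disjoint_iff.mp hv
    have haN' := mem_leftNeighborsIn.mp haN
    have hadj : H.Adj a v := (hH a v haN'.2.2).mpr
      ⟨hSR (hTS hvT), leftNeighborsIn_mono G (hTS.trans hSR) v haN, hac⟩
    exact hS (hTS haN'.1) (hTS hvT) haN'.2.2.ne hadj


/-! ### The recursion for `gammaBound` -/

theorem le_gammaBound {x l : ℝ} (hx : 1 ≤ x) (hl : 1 ≤ l) : x ≤ gammaBound x l := by
  have h1 : x ≤ x * l ^ 7 := le_mul_of_one_le_right (by linarith) (one_le_pow₀ hl)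
  have h2 : Real.Gamma (x + 1) ≤ Real.Gamma (x * l ^ 7 + 1) :=
    Real.Gamma_strictMonoOn_Ici.monotoneOn (Set.mem_Ici.mpr (by linarith))
      (Set.mem_Ici.mpr (by linarith)) (by linarith)
  have h3 : 0 < Real.Gamma (x + 1) := Real.Gamma_pos_of_pos (by linarith)
  exact le_mul_of_one_le_right (by linarith) (one_le_pow₀ ((one_le_div h3).mpr h2))

theorem div_Gamma_add_one_pow_three_anti {x x' : ℝ} (hx : 2 ≤ x) (hxx' : x ≤ x') :
    x' / Real.Gamma (x' + 1) ^ 3 ≤ x / Real.Gamma (x + 1) ^ 3 := by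
  have ha : 0 < Real.Gamma x := Real.Gamma_pos_of_pos (by linarith)
  have hab : Real.Gamma x ≤ Real.Gamma x' :=
    Real.Gamma_strictMonoOn_Ici.monotoneOn (Set.mem_Ici.mpr hx)
      (Set.mem_Ici.mpr (by linarith)) hxx'
  have hx0 : 0 < x := by linarith
  have hx0' : 0 < x' := by linarith
  rw [Real.Gamma_add_one hx0.ne', Real.Gamma_add_one hx0'.ne']
  have e : ∀ z g : ℝ, 0 < z → 0 < g → z / (z * g) ^ 3 = 1 / (z ^ 2 * g ^ 3) := by
    intro z g hz hg
    field_simp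
  rw [e _ _ hx0 ha, e _ _ hx0' (ha.trans_le hab)]
  gcongr

/-- Lowering `t` by 2 removes the factor `t * (t - 1)` from the numerator's Gamma value; raising `x`
only lowers `x / Γ(x + 1) ^ 3`. -/
theorem gammaBound_mul_le {x l x' l' t : ℝ} (hx : 2 ≤ x) (hxx' : x ≤ x') (ht : x * l ^ 7 = t)
    (ht' : x' * l' ^ 7 = t - 2) (ht1 : 2 < t) :
    gammaBound x' l' * (t * (t - 1)) ^ 3 ≤ gammaBound x l := by
  have hG : Real.Gamma (t + 1) = t * (t - 1) * Real.Gamma (t - 2 + 1) := by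
    rw [Real.Gamma_add_one (by linarith)]
    have : t = (t - 2 + 1) + 1 := by ring
    conv_lhs => rw [this, Real.Gamma_add_one (by linarith)]
    ring
  have h := div_Gamma_add_one_pow_three_anti hx hxx'
  unfold gammaBound
  rw [ht, ht', hG]
  have hg : 0 < Real.Gamma (t - 2 + 1) := Real.Gamma_pos_of_pos (by linarith)
  have h0 : 0 ≤ (t * (t - 1) * Real.Gamma (t - 2 + 1)) ^ 3 := by
    have : 0 < t - 1 := by linarith
    positivity
  have := mul_le_mul_of_nonneg_right h h0
  calc _ = x' / Real.Gamma (x' + 1) ^ 3 * (t * (t - 1) * Real.Gamma (t - 2 + 1)) ^ 3 := by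
        rw [div_pow]; ring
    _ ≤ _ := this
    _ = _ := by rw [div_pow]; ring

/-! ### Gluing and the induction -/

namespace HasSparseTriangleFree

variable {V : Type*} {G : SimpleGraph V} {w : V → ℝ} {S T : Finset V} {x x' : ℝ}

theorem anti (h : HasSparseTriangleFree G w S x') (hw : ∀ v, 0 ≤ w v) (hx : 0 < x)
    (hxx' : x ≤ x') : HasSparseTriangleFree G w S x := by
  obtain ⟨H, h1, h2, h3, h4⟩ := h
  refine ⟨H, h1, h2, h3, fun I hI hi => (h4 I hI hi).trans ?_⟩
  have : 0 ≤ ∑ v ∈ S, w v := Finset.sum_nonneg fun v _ => hw v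
  gcongr

theorem empty (G : SimpleGraph V) (w : V → ℝ) (x : ℝ) : HasSparseTriangleFree G w ∅ x := by
  refine ⟨⊥, bot_le, by simp, SimpleGraph.cliqueFree_bot (by norm_num),
    fun I hI _ => ?_⟩
  rw [Finset.subset_empty.mp hI]; simp

/-- With no edges between the two sides, a triangle lies in one of them and the weight bounds add.
-/
theorem union [DecidableEq V] (hS : HasSparseTriangleFree G w S x)
    (hT : HasSparseTriangleFree G w T x) (hST : Disjoint S T) :
    HasSparseTriangleFree G w (S ∪ T) x := by
  obtain ⟨H, h1, h2, h3, h4⟩ := hS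
  obtain ⟨K, k1, k2, k3, k4⟩ := hT
  have hd : ∀ a, a ∈ S → a ∈ T → False := fun a ha hb =>
    Finset.disjoint_left.mp hST ha hb
  refine ⟨H ⊔ K, sup_le h1 k1, ?_, ?_, ?_⟩
  · rintro a b (h | h)
    · exact ⟨Finset.mem_union_left _ (h2 _ _ h).1, Finset.mem_union_left _ (h2 _ _ h).2⟩
    · exact ⟨Finset.mem_union_right _ (k2 _ _ h).1, Finset.mem_union_right _ (k2 _ _ h).2⟩
  · intro s hs
    obtain ⟨a, b, c, hab, hac, hbc, rfl⟩ := SimpleGraph.is3Clique_iff.mp hs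
    rcases hab with hab | hab
    · have hac' : H.Adj a c := hac.resolve_right fun h => hd a (h2 _ _ hab).1 (k2 _ _ h).1
      have hbc' : H.Adj b c := hbc.resolve_right fun h => hd b (h2 _ _ hab).2 (k2 _ _ h).1
      exact h3 _ (SimpleGraph.is3Clique_iff.mpr ⟨a, b, c, hab, hac', hbc', rfl⟩)
    · have hac' : K.Adj a c := hac.resolve_left fun h => hd a (h2 _ _ h).1 (k2 _ _ hab).1
      have hbc' : K.Adj b c := hbc.resolve_left fun h => hd b (h2 _ _ h).1 (k2 _ _ hab).2
      exact k3 _ (SimpleGraph.is3Clique_iff.mpr ⟨a, b, c, hab, hac', hbc', rfl⟩)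
  · intro I hI hi
    have e1 := h4 (I ∩ S) Finset.inter_subset_right fun a ha b hb hab h =>
      hi (Finset.mem_inter.mp ha).1 (Finset.mem_inter.mp hb).1 hab (Or.inl h)
    have e2 := k4 (I ∩ T) Finset.inter_subset_right fun a ha b hb hab h =>
      hi (Finset.mem_inter.mp ha).1 (Finset.mem_inter.mp hb).1 hab (Or.inr h)
    have e3 : I = I ∩ S ∪ I ∩ T := by
      rw [← Finset.inter_union_distrib_left, Finset.inter_eq_left.mpr hI]
    rw [e3, Finset.sum_union
      (Finset.disjoint_of_subset_left Finset.inter_subset_right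
        (Finset.disjoint_of_subset_right Finset.inter_subset_right hST)),
      Finset.sum_union hST, add_div]
    exact add_le_add e1 e2

end HasSparseTriangleFree

/-- If the left neighbourhoods are independent, the graph itself is triangle-free. -/
theorem hasSparseTriangleFree_of_lt_two {V : Type*} [Fintype V] [LinearOrder V]
    (G : SimpleGraph V) (w : V → ℝ) (S : Finset V) (x l : ℝ) (hl : 0 < l) (hl2 : l < 2)
    (hindep : ∀ I ⊆ S, G.IsIndepSet (I : Set V) → ∑ v ∈ I, w v ≤ (∑ v ∈ S, w v) / x)
    (hcol : ∀ v ∈ S, FracColorableOn G (leftNeighborsIn G S v) l) :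
    HasSparseTriangleFree G w S x := by
  let H : SimpleGraph V :=
    { Adj := fun a b => G.Adj a b ∧ a ∈ S ∧ b ∈ S
      symm := ⟨fun a b h => ⟨h.1.symm, h.2.2, h.2.1⟩⟩
      loopless := ⟨fun a h => G.loopless.irrefl a h.1⟩ }
  refine ⟨H, fun a b h => h.1, fun a b h => h.2, ?_, ?_⟩
  · refine cliqueFree_three_of_left fun u v z huv hvz huz hvz' huv' => ?_
    refine (hcol z huz.2.2).isIndepSet hl hl2 ?_ ?_ huv.ne huv'.1
    · exact mem_leftNeighborsIn.mpr ⟨huz.2.1, huz.1, huv.trans hvz⟩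
    · exact mem_leftNeighborsIn.mpr ⟨hvz'.2.1, hvz'.1, hvz⟩
  · exact fun I hI hi => hindep I hI fun a ha b hb hab h => hi ha hb hab ⟨h, hI ha, hI hb⟩

open Finset in
theorem hasSparseTriangleFree_of_gammaBound {V : Type*} [Fintype V] [LinearOrder V]
    (G : SimpleGraph V) (w : V → ℝ) (hw : ∀ v, 0 ≤ w v)
    (horder : ∀ u v : V, u < v → w v ≤ w u) (n : ℕ) :
    ∀ (x l : ℝ) (S : Finset V), 59 ≤ x → 1 ≤ l → x * l ^ 7 ≤ n → 0 < ∑ v ∈ S, w v →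
      (∀ I ⊆ S, G.IsIndepSet (I : Set V) → ∑ v ∈ I, w v ≤ (∑ v ∈ S, w v) / gammaBound x l) →
      (∀ v ∈ S, FracColorableOn G (leftNeighborsIn G S v) l) →
      HasSparseTriangleFree G w S x := by
  classical
  induction n with
  | zero =>
    intro x l S hx hl hn
    have : 0 < x * l ^ 7 := by positivity
    rw [Nat.cast_zero] at hn
    linarith
  | succ n ih =>
    intro x l S hx hl hn hS hindep hcol
    have hx0 : 0 < x := by linarith
    have hl0 : 0 < l := by linarith
    rcases lt_or_ge l 2 with hl2 | hl2
    · refine hasSparseTriangleFree_of_lt_two G w S x l hl0 hl2 (fun I hI hi => ?_) hcol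
      refine (hindep I hI hi).trans ?_
      gcongr
      exact le_gammaBound (by linarith) hl
    obtain ⟨t, ht⟩ : ∃ t, x * l ^ 7 = t := ⟨_, rfl⟩
    rw [ht] at hn
    push_cast at hn
    have htx : 128 * x ≤ t := by
      have : (2 : ℝ) ^ 7 ≤ l ^ 7 := by gcongr
      nlinarith
    have ht1 : 0 < t - 1 := by linarith
    have ht0 : 0 < t := by linarith
    -- Chosen so that `1 / x = 1 / x' + 1 / (x * t)`: a remainder of relative weight `1 / (x * t)`
    -- can be discarded.
    set x' := x * t / (t - 1) with hx'
    have hxx' : x ≤ x' := by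
      rw [hx', le_div_iff₀ ht1]; nlinarith
    have hx0' : 0 < x' := by linarith
    have hquot : 0 < (t - 2) / x' := div_pos (by linarith) hx0'
    obtain ⟨l', hl0', hl'⟩ : ∃ l' : ℝ, 0 < l' ∧ l' ^ 7 = (t - 2) / x' :=
      ⟨((t - 2) / x') ^ (1 / 7 : ℝ), by positivity, by
        rw [← Real.rpow_natCast, ← Real.rpow_mul hquot.le]; norm_num⟩
    have ht' : x' * l' ^ 7 = t - 2 := by rw [hl']; field_simp
    have hratio : (1 - 3 / t) * l ≤ l' := by
      have h1 : 0 ≤ 1 - 3 / t := by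
        rw [sub_nonneg, div_le_one ht0]; linarith
      have h2 : 1 - 3 / t ≤ 1 := by
        have : 0 < 3 / t := by positivity
        linarith
      rw [← pow_le_pow_iff_left₀ (by positivity) hl0'.le (n := 7) (by norm_num), mul_pow, hl']
      have h3 : (1 - 3 / t) ^ 7 ≤ 1 - 3 / t := pow_le_of_le_one h1 h2 (by norm_num)
      have h4 : l ^ 7 = t / x := by rw [← ht]; field_simp
      calc (1 - 3 / t) ^ 7 * l ^ 7 ≤ (1 - 3 / t) * l ^ 7 := by gcongr
        _ = (t - 3) / x := by rw [h4]; field_simp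
        -- Amounts to `t * (t - 3) ≤ (t - 1) * (t - 2)`.
        _ ≤ (t - 2) / x' := by
          rw [div_le_div_iff₀ hx0 hx0', hx', ← mul_div_assoc, div_le_iff₀ ht1]
          nlinarith
    have hl1' : 1 ≤ l' := by
      have : 3 / t ≤ 1 / 2 := by rw [div_le_div_iff₀ ht0 (by norm_num)]; linarith
      nlinarith
    set τ := (t * (t - 1)) ^ 3 with hτ
    have hτ0 : 0 < τ := by positivity
    have hgam : gammaBound x' l' * τ ≤ gammaBound x l :=
      gammaBound_mul_le (by linarith) hxx' ht ht' (by linarith)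
    have hgam' : 0 < gammaBound x' l' := hx0'.trans_le (le_gammaBound (by linarith) hl1')
    have hpiece : ∀ A ⊆ S, (∀ v ∈ A, FracColorableOn G (leftNeighborsIn G A v) l') →
        (∑ v ∈ S, w v) / τ < ∑ v ∈ A, w v → HasSparseTriangleFree G w A x' := by
      intro A hAS hA hwA
      refine ih x' l' A (by linarith) hl1' (by linarith) (lt_trans (by positivity) hwA) ?_ hA
      intro I hI hi
      refine (hindep I (hI.trans hAS) hi).trans ?_
      rw [div_lt_iff₀ hτ0] at hwA
      calc (∑ v ∈ S, w v) / gammaBound x l ≤ (∑ v ∈ S, w v) / (gammaBound x' l' * τ) := by gcongr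
        _ ≤ ((∑ v ∈ A, w v) * τ) / (gammaBound x' l' * τ) := by gcongr
        _ = _ := mul_div_mul_right _ _ hτ0.ne'
    obtain ⟨U, hU, hUmax⟩ := exists_max_image
      (S.powerset.filter fun U => HasSparseTriangleFree G w U x') card
      ⟨∅, by simp [HasSparseTriangleFree.empty]⟩
    simp only [mem_filter, mem_powerset] at hU hUmax
    obtain ⟨hUS, hUx'⟩ := hU
    have hwR := sum_sdiff (f := w) hUS
    have hno : ∀ A ⊆ S \ U, (∀ v ∈ A, FracColorableOn G (leftNeighborsIn G A v) l') →
        ∑ v ∈ A, w v ≤ (∑ v ∈ S, w v) / τ := by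
      intro A hA hAcol
      by_contra! hcon
      have hAS := hA.trans sdiff_subset
      have hdisj : Disjoint U A := disjoint_of_subset_right hA disjoint_sdiff
      have h1 := hUmax (U ∪ A)
        ⟨union_subset hUS hAS, hUx'.union (hpiece A hAS hAcol hcon) hdisj⟩
      rw [card_union_of_disjoint hdisj] at h1
      have h2 : A = ∅ := card_eq_zero.mp (by omega)
      rw [h2, sum_empty] at hcon
      exact absurd hcon (not_lt.mpr (by positivity))
    have hwU : 0 ≤ ∑ v ∈ U, w v := sum_nonneg fun v _ => hw v
    rcases le_or_gt (∑ v ∈ S \ U, w v) ((∑ v ∈ S, w v) / (x * t)) with hsmall | hbig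
    · obtain ⟨H, h1, h2, h3, h4⟩ := hUx'
      refine ⟨H, h1, fun a b h => ⟨hUS (h2 a b h).1, hUS (h2 a b h).2⟩, h3, fun I hI hi => ?_⟩
      have e1 := h4 (I ∩ U) inter_subset_right fun a ha b hb hab h =>
        hi (mem_inter.mp ha).1 (mem_inter.mp hb).1 hab h
      have e2 : ∑ v ∈ I \ U, w v ≤ ∑ v ∈ S \ U, w v :=
        sum_le_sum_of_subset_of_nonneg (sdiff_subset_sdiff hI (subset_refl _)) fun v _ _ => hw v
      have e3 := sum_inter_add_sum_sdiff I U w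
      have e4 : (∑ v ∈ U, w v) / x' ≤ (∑ v ∈ S, w v) / x' := by
        have := sum_le_sum_of_subset_of_nonneg hUS fun v _ _ => hw v
        gcongr
      have e5 : (∑ v ∈ S, w v) / x = (∑ v ∈ S, w v) / x' + (∑ v ∈ S, w v) / (x * t) := by
        rw [hx']; field_simp; ring
      linarith
    · have hR : HasSparseTriangleFree G w (S \ U) x := by
        refine exists_triangleFree_of_no_piece G w hw horder (S \ U) x t l l'
          ((∑ v ∈ S, w v) / τ) hx0 (by linarith) hl0 ?_ ?_ ?_ hno ?_
        · rw [sub_le_comm, le_div_iff₀ hl0]; exact hratio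
        -- The requirement is `36 * e * x ≤ t`; the exponent 7 suffices because `36 * e < 98 < 2 ^
        -- 7`.
        · have he := Real.exp_one_lt_d9
          have : 2 * x * Real.exp 1 * (6 / t) = (12 * x * Real.exp 1) / t := by ring
          rw [this, div_le_div_iff₀ ht0 (by norm_num)]
          nlinarith
        · exact fun v hv => (hcol v (sdiff_subset hv)).mono
            (leftNeighborsIn_mono G sdiff_subset v)
        · have key : (t + 2) / τ ≤ 1 / (x * t) / (2 * x) := by
            rw [div_div, div_le_div_iff₀ hτ0 (by positivity), one_mul]
            calc (t + 2) * (x * t * (2 * x)) ≤ (t + 2) * (t * t * (2 * t)) := by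
                  gcongr <;> linarith
              _ ≤ τ := by
                  have h5 : 2 * (t + 2) ≤ (t - 1) ^ 3 := by
                    have : 7000 ≤ t - 1 := by linarith
                    nlinarith [mul_pos ht1 ht1]
                  have h6 : τ = t ^ 3 * (t - 1) ^ 3 := by rw [hτ, mul_pow]
                  rw [h6]
                  calc _ = t ^ 3 * (2 * (t + 2)) := by ring
                    _ ≤ _ := by gcongr
          calc (t + 2) * ((∑ v ∈ S, w v) / τ) = (∑ v ∈ S, w v) * ((t + 2) / τ) := by ring
            _ ≤ (∑ v ∈ S, w v) * (1 / (x * t) / (2 * x)) := by gcongr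
            _ = (∑ v ∈ S, w v) / (x * t) / (2 * x) := by ring
            _ ≤ _ := by gcongr
      have := (hUx'.anti hw hx0 hxx').union hR disjoint_sdiff
      rwa [union_sdiff_of_subset hUS] at this


/-! ### The fractional chromatic number -/

theorem mem_indepSets {V : Type*} [Fintype V] {G : SimpleGraph V} {I : Finset V} :
    I ∈ indepSets G ↔ G.IsIndepSet (I : Set V) := by
  simp [indepSets]

open scoped Classical in
theorem isFractionalColoring_one {V : Type*} [Fintype V] (G : SimpleGraph V) :
    IsFractionalColoring G fun _ => 1 := by
  refine ⟨fun _ _ => zero_le_one, fun v => ?_⟩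
  refine Finset.single_le_sum (f := fun _ : Finset V => (1 : ℝ)) (fun _ _ => zero_le_one)
    (a := {v}) ?_
  rw [Finset.mem_filter, mem_indepSets]
  simp

/-- Truncating a fractional colouring at `1` gives a fractional colouring. -/
theorem IsFractionalColoring.min_one {V : Type*} [Fintype V] {G : SimpleGraph V}
    {y : Finset V → ℝ} (hy : IsFractionalColoring G y) :
    IsFractionalColoring G fun I => max 0 (min (y I) 1) := by
  classical
  refine ⟨fun _ _ => le_max_left _ _, fun v => ?_⟩
  by_cases h : ∃ I ∈ (indepSets G).filter (fun I => v ∈ I), 1 ≤ y I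
  · obtain ⟨I, hI, h1⟩ := h
    refine le_trans ?_ (Finset.single_le_sum (fun _ _ => le_max_left _ _) hI)
    simp [h1]
  · push Not at h
    refine (hy.2 v).trans (Finset.sum_le_sum fun I hI => ?_)
    rw [min_eq_left (h I hI).le]
    exact le_max_right _ _

/-- The infimum in the definition of the fractional chromatic number is attained. -/
theorem exists_isFractionalColoring_sum_eq {V : Type*} [Fintype V] (G : SimpleGraph V) :
    ∃ y, IsFractionalColoring G y ∧ ∑ I ∈ indepSets G, y I = fractionalChromaticNumber G := by
  classical
  -- Truncation never raises the total, so minimising over this compact set is enough.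
  let K : Set (Finset V → ℝ) := Set.Icc 0 1 ∩ {y | IsFractionalColoring G y}
  have hclosed : IsClosed {y : Finset V → ℝ | IsFractionalColoring G y} := by
    have : {y : Finset V → ℝ | IsFractionalColoring G y} =
        (⋂ I ∈ indepSets G, {y : Finset V → ℝ | 0 ≤ y I}) ∩
        ⋂ v : V, {y : Finset V → ℝ |
          1 ≤ ∑ I ∈ (indepSets G).filter (fun I => v ∈ I), y I} := by
      ext y
      simp only [IsFractionalColoring, Set.mem_ofPred_eq, Set.mem_inter_iff, Set.mem_iInter]
    rw [this]
    refine (isClosed_biInter fun I _ => ?_).inter (isClosed_iInter fun v => ?_)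
    · exact isClosed_le continuous_const (continuous_apply I)
    · exact isClosed_le continuous_const (by fun_prop)
  have hK : IsCompact K := isCompact_Icc.inter_right hclosed
  have hne : K.Nonempty :=
    ⟨fun _ => 1, Set.mem_inter (Set.mem_Icc.mpr ⟨fun _ => zero_le_one, fun _ => le_rfl⟩)
      (isFractionalColoring_one G)⟩
  obtain ⟨y, hyK, hmin⟩ := hK.exists_isMinOn hne
    (f := fun y : Finset V → ℝ => ∑ I ∈ indepSets G, y I) (by fun_prop)
  refine ⟨y, hyK.2, ?_⟩
  symm
  apply IsLeast.csInf_eq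
  refine ⟨⟨y, hyK.2, rfl⟩, ?_⟩
  rintro c ⟨z, hz, rfl⟩
  have hz' : (fun I => max 0 (min (z I) 1)) ∈ K :=
    ⟨⟨fun _ => le_max_left _ _, fun _ => max_le zero_le_one (min_le_right _ _)⟩, hz.min_one⟩
  refine (hmin hz').trans (Finset.sum_le_sum fun I hI => ?_)
  exact max_le (hz.1 I hI) (min_le_left _ _)

/-- A finite family of independent sets with weights of total at most `l` covering every vertex
of `A`, normalised to a probability distribution. -/
theorem FracColorableOn.of_family {V α : Type*} [Fintype V] [DecidableEq V]
    {G : SimpleGraph V} {A : Finset V} {l : ℝ} (s : Finset α) (φ : α → Finset V) (y : α → ℝ)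
    (hl : 0 < l) (hφ : ∀ a ∈ s, G.IsIndepSet (φ a : Set V)) (hy : ∀ a ∈ s, 0 ≤ y a)
    (hsum : ∑ a ∈ s, y a ≤ l) (hcov : ∀ u ∈ A, 1 ≤ ∑ a ∈ s with u ∈ φ a, y a) :
    FracColorableOn G A l := by
  classical
  have hrest : 0 ≤ 1 - (∑ a ∈ s, y a) / l := by
    rw [sub_nonneg, div_le_one hl]; exact hsum
  have hfib : ∀ J, 0 ≤ (∑ a ∈ s with φ a = J, y a) / l := fun J =>
    div_nonneg (Finset.sum_nonneg fun a ha => hy a (Finset.mem_filter.mp ha).1) hl.le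
  -- The mass missing from a total below `l` is put on the empty set.
  refine ⟨fun J => (∑ a ∈ s with φ a = J, y a) / l +
    if J = ∅ then 1 - (∑ a ∈ s, y a) / l else 0, fun J => ?_, fun J hJ => ?_, ?_, ?_⟩
  · refine add_nonneg (hfib J) ?_
    split_ifs <;> simp [hrest]
  · by_cases h : J = ∅
    · subst h; simp
    · simp only [h, if_false, add_zero] at hJ
      obtain ⟨a, ha, -⟩ := Finset.exists_ne_zero_of_sum_ne_zero (div_ne_zero_iff.mp hJ).1
      rw [Finset.mem_filter] at ha
      rw [← ha.2]
      exact hφ a ha.1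
  · rw [Finset.sum_add_distrib, ← Finset.sum_div, Finset.sum_fiberwise]
    simp
  · intro u hu
    have h1 : ∑ a ∈ s with u ∈ φ a, y a = ∑ J with u ∈ J, ∑ a ∈ s with φ a = J, y a := by
      rw [Finset.sum_filter, ← Finset.sum_fiberwise s φ, Finset.sum_filter]
      refine Finset.sum_congr rfl fun J _ => ?_
      by_cases hJ : u ∈ J
      · rw [if_pos hJ]
        refine Finset.sum_congr rfl fun a ha => ?_
        rw [if_pos]
        rwa [(Finset.mem_filter.mp ha).2]
      · rw [if_neg hJ]
        refine Finset.sum_eq_zero fun a ha => ?_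
        rw [if_neg]
        rwa [(Finset.mem_filter.mp ha).2]
    calc (1 : ℝ) ≤ ∑ J with u ∈ J, ∑ a ∈ s with φ a = J, y a := h1 ▸ hcov u hu
      _ = l * ∑ J with u ∈ J, (∑ a ∈ s with φ a = J, y a) / l := by
          rw [← Finset.sum_div]; field_simp
      _ ≤ _ := by
          gcongr with J _
          refine le_add_of_nonneg_right ?_
          split_ifs <;> simp [hrest]

theorem fracColorableOn_of_fractionalChromaticNumber_le {V : Type*} [Fintype V] [DecidableEq V]
    (G : SimpleGraph V) (s : Set V) [Fintype s] (A : Finset V) (hA : ∀ u ∈ A, u ∈ s) (l : ℝ)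
    (hl : 0 < l) (h : fractionalChromaticNumber (G.induce s) ≤ l) : FracColorableOn G A l := by
  classical
  obtain ⟨y, hy, hsum⟩ := exists_isFractionalColoring_sum_eq (G.induce s)
  refine FracColorableOn.of_family (indepSets (G.induce s))
    (fun I => I.map (Function.Embedding.subtype _)) y hl (fun I hI => ?_) hy.1 (hsum.trans_le h)
    fun u hu => ?_
  · rw [mem_indepSets] at hI
    intro a ha b hb hab hadj
    simp only [Finset.coe_map, Function.Embedding.subtype_apply, Set.mem_image,
      Finset.mem_coe] at ha hb
    obtain ⟨a, ha, rfl⟩ := ha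
    obtain ⟨b, hb, rfl⟩ := hb
    exact hI ha hb (fun h => hab (congrArg _ h)) hadj
  · refine (hy.2 ⟨u, hA u hu⟩).trans (le_of_eq (Finset.sum_congr ?_ fun _ _ => rfl))
    ext I
    simp [hA u hu]

/-- The weighted lower bound for the fractional chromatic number. -/
theorem le_fractionalChromaticNumber_of_weight {V : Type*} [Fintype V] (H : SimpleGraph V)
    (w : V → ℝ) (hw : ∀ v, 0 ≤ w v) (hwV : 0 < ∑ v, w v) (x : ℝ) (hx : 0 < x)
    (h : ∀ I : Finset V, H.IsIndepSet (I : Set V) → ∑ v ∈ I, w v ≤ (∑ v, w v) / x) :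
    x ≤ fractionalChromaticNumber H := by
  classical
  refine le_csInf ⟨_, _, isFractionalColoring_one H, rfl⟩ ?_
  rintro c ⟨y, hy, rfl⟩
  have h1 : ∑ v, w v ≤ ∑ I ∈ indepSets H, y I * ∑ v ∈ I, w v := by
    calc ∑ v, w v ≤ ∑ v, w v * ∑ I ∈ (indepSets H).filter (fun I => v ∈ I), y I :=
          Finset.sum_le_sum fun v _ => le_mul_of_one_le_right (hw v) (hy.2 v)
      _ = ∑ v, ∑ I ∈ indepSets H, if v ∈ I then y I * w v else 0 := by
          refine Finset.sum_congr rfl fun v _ => ?_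
          rw [Finset.sum_filter, Finset.mul_sum]
          refine Finset.sum_congr rfl fun I _ => ?_
          split_ifs <;> ring
      _ = _ := by
          rw [Finset.sum_comm]
          refine Finset.sum_congr rfl fun I _ => ?_
          rw [Finset.mul_sum, Finset.sum_ite_mem, Finset.univ_inter]
  have h2 : ∑ I ∈ indepSets H, y I * ∑ v ∈ I, w v ≤
      (∑ I ∈ indepSets H, y I) * ((∑ v, w v) / x) := by
    rw [Finset.sum_mul]
    exact Finset.sum_le_sum fun I hI =>
      mul_le_mul_of_nonneg_left (h I (mem_indepSets.mp hI)) (hy.1 I hI)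
  have h3 := h1.trans h2
  rw [← mul_div_assoc, le_div_iff₀ hx, mul_comm] at h3
  exact le_of_mul_le_mul_right h3 hwV

theorem mainTheorem2 {V : Type*} [Fintype V] [LinearOrder V] (G : SimpleGraph V)
    (w : V → ℝ) (hw : ∀ v, 0 ≤ w v) (hwV : ∑ v, w v ≠ 0)
    (horder : ∀ u v : V, u < v → w v ≤ w u)
    (x l : ℝ) (hx : 59 ≤ x) (hl : 1 ≤ l)
    (hindep : ∀ I : Finset V, G.IsIndepSet (I : Set V) →
      ∑ v ∈ I, w v ≤ (∑ v, w v) / gammaBound x l)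
    (hleft : ∀ v : V, fractionalChromaticNumber (G.induce (leftNeighborSet G v)) ≤ l) :
    ∃ H : SimpleGraph V, H ≤ G ∧ H.CliqueFree 3 ∧
      (∀ I : Finset V, H.IsIndepSet (I : Set V) → ∑ v ∈ I, w v ≤ (∑ v, w v) / x) ∧
      x ≤ fractionalChromaticNumber H := by
  have hpos : 0 < ∑ v, w v := (Finset.sum_nonneg fun v _ => hw v).lt_of_ne' hwV
  obtain ⟨n, hn⟩ := exists_nat_ge (x * l ^ 7)
  obtain ⟨H, h1, -, h3, h4⟩ := hasSparseTriangleFree_of_gammaBound G w hw horder n x l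
    Finset.univ hx hl hn hpos (fun I _ hi => hindep I hi) fun v _ =>
      fracColorableOn_of_fractionalChromaticNumber_le G (leftNeighborSet G v) _
        (fun u hu => (mem_leftNeighborsIn.mp hu).2) l (by linarith) (hleft v)
  have h5 := fun I : Finset V => h4 I (Finset.subset_univ I)
  exact ⟨H, h1, h3, h5, le_fractionalChromaticNumber_of_weight H w hw hpos x (by linarith) h5⟩
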